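/- Let $X$ be a compact Hausdorff space with a base point $x_0$, and let $A$ be a unital C*-algebra. Let $\Sigma X = ([0,1]\times X)/(\{0,1\}\times X\cup [0,1]\times\{x_0\})$ be the reduced suspension of $X$, and identify $C(\Sigma X)\otimes A$ with the C*-algebra $C(\Sigma X, A)$ of continuous functions $\Sigma X\to A$. Then \[ gsr(C(\Sigma X)\otimes A) = \max\{gsr(A), \mathrm{inj}_X(A)\} \] as elements of $\{1,2,\ldots\}\cup\{+\infty\}$, with the following notation. For a unital C*-algebra $B$ and $m\in\mathbb{N}$, let $GL_m(B)$ be the set of invertible matrices in $M_m(B)$, with the subspace topology and base point $I_m$ (so $GL_0(B)$ is a single point), and let $Lg_m(B)$ be the set of left unimodular vectors, i.e. of those $(b_1,\ldots,b_m)\in B^m$ for which there is $(b_1',\ldots,b_m')\in B^m$ with $\sum_i b_i'b_i = 1$. The general stable rank $gsr(B)$ is the least $n\geq 1$ such that, for all $m\geq n$, $GL_m(B)$ acts transitively on $Lg_m(B)$ by left multiplication; $gsr(B)=+\infty$ if there is no such $n$. For pointed spaces $Y, Z$, $[Y,Z]_*$ is the set of based homotopy classes of based continuous maps $Y\to Z$.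 The number $\mathrm{inj}_X(A)$ is the least $n\geq 1$ such that, for all $m\geq n$, the map $[X,GL_{m-1}(A)]_*\to [X,GL_m(A)]_*$ induced by $a\mapsto \begin{pmatrix} a & 0\\ 0 & 1\end{pmatrix}$ is injective; $\mathrm{inj}_X(A)=+\infty$ if there is no such $n$. -/

import Mathlib

namespace StableRank

/-! ### The general stable rank -/

section GeneralStableRank

/-- A vector `a ∈ Aⁿ` is left unimodular if `A a₁ + ⋯ + A aₙ = A`, that is, if
`∑ a'ᵢ aᵢ = 1` for some `a' ∈ Aⁿ`. The set of these vectors is `Lgₙ(A)`. -/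
def Lg (n : ℕ) (A : Type*) [Ring A] : Set (Fin n → A) :=
  {a | ∃ a' : Fin n → A, ∑ i, a' i * a i = 1}

/-- `GLₙ(A)`: the invertible `n × n` matrices, with the topology (if `A` has one) of a subspace
of `Mₙ(A)`. In particular `GL₀(A)` is a single point. -/
abbrev GLn (n : ℕ) (A : Type*) [Ring A] : Type _ :=
  {T : Matrix (Fin n) (Fin n) A // IsUnit T}

/-- The identity matrix, the base point of `GLₙ(A)`. -/
def GLn.one (n : ℕ) (A : Type*) [Ring A] : GLn n A := ⟨1, isUnit_one⟩

/-- `GLₙ(A)`, acting by left multiplication, acts transitively on `Lgₙ(A)`. -/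
def ActsTransitively (n : ℕ) (A : Type*) [Ring A] : Prop :=
  ∀ a ∈ Lg n A, ∀ b ∈ Lg n A, ∃ T : GLn n A, T.1.mulVec a = b

/-- The general stable rank: the least `n ≥ 1` such that `GLₘ(A)` acts transitively on `Lgₘ(A)`
for all `m ≥ n`, and `⊤` if there is no such `n`. -/
noncomputable def gsr (A : Type*) [Ring A] : ℕ∞ :=
  sInf ((fun n : ℕ => (n : ℕ∞)) '' {n : ℕ | 1 ≤ n ∧ ∀ m, n ≤ m → ActsTransitively m A})

end GeneralStableRank

/-! ### Based homotopy classes -/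

section BasedHomotopy

variable {X Y Z : Type*} [TopologicalSpace X] [TopologicalSpace Y] [TopologicalSpace Z]

/-- Two based maps `(X, x₀) → (Y, y₀)` are equivalent if they are homotopic through based maps. -/
def basedSetoid (x₀ : X) (y₀ : Y) : Setoid {f : C(X, Y) // f x₀ = y₀} where
  r f g := ContinuousMap.HomotopicRel f.1 g.1 {x₀}
  iseqv := ⟨fun f => .refl f.1, fun h => h.symm, fun h h' => h.trans h'⟩

/-- `[X, Y]_*`, the set of based homotopy classes of maps `(X, x₀) → (Y, y₀)`. -/
def BasedClasses (x₀ : X) (y₀ : Y) : Type _ := Quotient (basedSetoid x₀ y₀)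

/-- The map `[X, Y]_* → [X, Z]_*` induced by a based map `g : (Y, y₀) → (Z, z₀)`. -/
def BasedClasses.map (x₀ : X) {y₀ : Y} {z₀ : Z} (g : C(Y, Z)) (hg : g y₀ = z₀) :
    BasedClasses x₀ y₀ → BasedClasses x₀ z₀ :=
  Quotient.map (fun f => ⟨g.comp f.1, by rw [ContinuousMap.comp_apply, f.2, hg]⟩)
    (fun _ _ h => ContinuousMap.HomotopicRel.comp_continuousMap h g)

end BasedHomotopy

/-! ### The number `inj_X(A)` -/

section Inj

variable {A : Type*} [Ring A]

/-- The block matrix `diag(T, 1)`, of size `k + 1`. -/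
def addOne {k : ℕ} (T : Matrix (Fin k) (Fin k) A) : Matrix (Fin (k + 1)) (Fin (k + 1)) A :=
  (Matrix.fromBlocks T 0 0 (1 : Matrix (Fin 1) (Fin 1) A)).reindex finSumFinEquiv finSumFinEquiv

theorem addOne_one (k : ℕ) : addOne (1 : Matrix (Fin k) (Fin k) A) = 1 := by
  simp [addOne]

theorem addOne_mul {k : ℕ} (S T : Matrix (Fin k) (Fin k) A) :
    addOne S * addOne T = addOne (S * T) := by
  simp [addOne, Matrix.submatrix_mul_equiv, Matrix.fromBlocks_multiply]

theorem isUnit_addOne {k : ℕ} {T : Matrix (Fin k) (Fin k) A} (hT : IsUnit T) :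
    IsUnit (addOne T) := by
  obtain ⟨u, rfl⟩ := hT
  exact ⟨⟨addOne u.1, addOne u.2, by rw [addOne_mul, u.val_inv, addOne_one],
    by rw [addOne_mul, u.inv_val, addOne_one]⟩, rfl⟩

/-- The continuous map `θ : GLₖ(A) → GLₖ₊₁(A)`, `T ↦ diag(T, 1)`. -/
def theta (k : ℕ) (A : Type*) [Ring A] [TopologicalSpace A] : C(GLn k A, GLn (k + 1) A) where
  toFun T := ⟨addOne T.1, isUnit_addOne T.2⟩
  continuous_toFun := by
    refine Continuous.subtype_mk ?_ _
    exact (continuous_subtype_val.matrix_fromBlocks continuous_const continuous_const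
      continuous_const).matrix_reindex _ _

theorem theta_one (k : ℕ) (A : Type*) [Ring A] [TopologicalSpace A] :
    theta k A (GLn.one k A) = GLn.one (k + 1) A :=
  Subtype.ext (addOne_one k)

/-- `inj_X(A)`, for a space `X` with base point `x₀`: the least `n ≥ 1` such that
`[X, GLₘ₋₁(A)]_* → [X, GLₘ(A)]_*` is injective for all `m ≥ n` (below, `m = k + 1`), and `⊤` if
there is no such `n`. -/
noncomputable def inj {X : Type*} [TopologicalSpace X] (x₀ : X)
    (A : Type*) [Ring A] [TopologicalSpace A] : ℕ∞ :=
  sInf ((fun n : ℕ => (n : ℕ∞)) '' {n : ℕ | 1 ≤ n ∧ ∀ k, n ≤ k + 1 →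
    Function.Injective (BasedClasses.map x₀ (theta k A) (theta_one k A))})

end Inj

/-! ### The reduced suspension -/

section Suspension

variable {X : Type*}

/-- The subset `{0, 1} × X ∪ [0, 1] × {x₀}` of `[0, 1] × X`. -/
def suspensionCollapse (x₀ : X) : Set (unitInterval × X) :=
  {p | p.1 = 0 ∨ p.1 = 1 ∨ p.2 = x₀}

/-- The equivalence relation that identifies all points of `suspensionCollapse x₀`. -/
def suspensionSetoid (x₀ : X) : Setoid (unitInterval × X) where
  r p q := p = q ∨ (p ∈ suspensionCollapse x₀ ∧ q ∈ suspensionCollapse x₀)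
  iseqv := by
    refine ⟨fun _ => Or.inl rfl, ?_, ?_⟩
    · rintro p q (h | h)
      · exact Or.inl h.symm
      · exact Or.inr ⟨h.2, h.1⟩
    · rintro p q r (rfl | h) (rfl | h')
      · exact Or.inl rfl
      · exact Or.inr h'
      · exact Or.inr h
      · exact Or.inr ⟨h.1, h'.2⟩

/-- The reduced suspension `ΣX` of `(X, x₀)`, with the quotient topology. -/
abbrev Suspension (x₀ : X) : Type _ := Quotient (suspensionSetoid x₀)

end Suspension

end StableRank

/-! The equality holds size by size: by `actsTransitively_suspension_iff`, transitivity over C(ΣX,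
A) in size k + 1 is transitivity over A together with injectivity of `theta k` on based classes.
Both conditions on n define upper sets, so `sInf_image_cast_inter` turns their conjunction into a
maximum.

Behind this is the orbit map T ↦ T e of GLₖ₊₁(A) into Lgₖ₊₁(A), e the last basis vector. It lifts
homotopies (`exists_lift`), and the stabiliser of e consists of the blocks [[T, 0], [c, 1]], which
contract onto GLₖ(A). A unimodular vector over ΣX, normalised to e at the base point, is a family of
loops at e. Its lift from 1 ends in the stabiliser, giving a map X → GLₖ(A) that dies in GLₖ₊₁(A).
If that map is already null-homotopic, the lift can be corrected to descend to ΣX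
(`actsTransitively_suspension`). Conversely, every map that dies arises in this way, and a lift over
ΣX contracts it (`nullHomotopic_of_actsTransitively`). -/

namespace StableRank

open scoped unitInterval Matrix
open Set

/-! ### Block matrices and the stabiliser of the last basis vector -/

section Algebra

variable {R : Type*} [Ring R] {k : ℕ}

/-- The block matrix `[[T, 0], [c, 1]]`, of size `k + 1`. -/
def lowerBlock (T : Matrix (Fin k) (Fin k) R) (c : Matrix (Fin 1) (Fin k) R) :
    Matrix (Fin (k + 1)) (Fin (k + 1)) R :=
  (Matrix.fromBlocks T 0 c 1).reindex finSumFinEquiv finSumFinEquiv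

/-- The upper left `k × k` block. -/
def corner (M : Matrix (Fin (k + 1)) (Fin (k + 1)) R) : Matrix (Fin k) (Fin k) R :=
  (M.reindex finSumFinEquiv.symm finSumFinEquiv.symm).toBlocks₁₁

/-- The lower left `1 × k` block. -/
def bottomRow (M : Matrix (Fin (k + 1)) (Fin (k + 1)) R) : Matrix (Fin 1) (Fin k) R :=
  (M.reindex finSumFinEquiv.symm finSumFinEquiv.symm).toBlocks₂₁

/-- The last standard basis vector. -/
def lastVec (k : ℕ) (R : Type*) [Ring R] : Fin (k + 1) → R := Pi.single (Fin.last k) 1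

theorem addOne_eq_lowerBlock (T : Matrix (Fin k) (Fin k) R) : addOne T = lowerBlock T 0 := rfl

theorem lowerBlock_one_zero : lowerBlock (1 : Matrix (Fin k) (Fin k) R) 0 = 1 := addOne_one k

theorem lowerBlock_mul (S T : Matrix (Fin k) (Fin k) R) (c d : Matrix (Fin 1) (Fin k) R) :
    lowerBlock S c * lowerBlock T d = lowerBlock (S * T) (c * T + d) := by
  simp [lowerBlock, Matrix.submatrix_mul_equiv, Matrix.fromBlocks_multiply]

@[simp] theorem corner_lowerBlock (T : Matrix (Fin k) (Fin k) R) (c : Matrix (Fin 1) (Fin k) R) :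
    corner (lowerBlock T c) = T := by
  ext i j
  simp [corner, lowerBlock, Matrix.toBlocks₁₁]

@[simp] theorem bottomRow_lowerBlock (T : Matrix (Fin k) (Fin k) R)
    (c : Matrix (Fin 1) (Fin k) R) : bottomRow (lowerBlock T c) = c := by
  ext i j
  simp [bottomRow, lowerBlock, Matrix.toBlocks₂₁]

theorem finSumFinEquiv_inr_zero (i : Fin 1) :
    (finSumFinEquiv (Sum.inr i) : Fin (k + 1)) = Fin.last k := by
  ext; simp

theorem mulVec_lastVec (M : Matrix (Fin (k + 1)) (Fin (k + 1)) R) (i : Fin (k + 1)) :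
    (M *ᵥ lastVec k R) i = M i (Fin.last k) := by
  simp [lastVec]

theorem lowerBlock_mulVec_lastVec (T : Matrix (Fin k) (Fin k) R) (c : Matrix (Fin 1) (Fin k) R) :
    lowerBlock T c *ᵥ lastVec k R = lastVec k R := by
  ext i
  rw [mulVec_lastVec, ← finSumFinEquiv_inr_zero 0]
  obtain ⟨i | i, rfl⟩ := finSumFinEquiv.surjective i
  · simp only [lowerBlock, Matrix.reindex_apply, Matrix.submatrix_apply, Equiv.symm_apply_apply,
      Matrix.fromBlocks_apply₁₂, lastVec]
    rw [Pi.single_eq_of_ne]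
    · rfl
    · rw [← finSumFinEquiv_inr_zero 0, finSumFinEquiv.injective.ne_iff]
      simp
  · simp [lowerBlock, lastVec, finSumFinEquiv_inr_zero, Subsingleton.elim i 0, -finSumFinEquiv_apply_right]

theorem eq_lowerBlock {M : Matrix (Fin (k + 1)) (Fin (k + 1)) R}
    (hM : M *ᵥ lastVec k R = lastVec k R) : M = lowerBlock (corner M) (bottomRow M) := by
  ext i j
  have h := lowerBlock_mulVec_lastVec (corner M) (bottomRow M)
  obtain ⟨j | j, rfl⟩ := finSumFinEquiv.surjective j
  · obtain ⟨i | i, rfl⟩ := finSumFinEquiv.surjective i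
    · simp [lowerBlock, corner, Matrix.toBlocks₁₁]
    · simp [lowerBlock, bottomRow, Matrix.toBlocks₂₁]
  · rw [finSumFinEquiv_inr_zero, ← mulVec_lastVec M, ← mulVec_lastVec (lowerBlock _ _), hM, h]

theorem isUnit_lowerBlock {T : Matrix (Fin k) (Fin k) R} (hT : IsUnit T)
    (c : Matrix (Fin 1) (Fin k) R) : IsUnit (lowerBlock T c) := by
  have h : IsUnit (lowerBlock (1 : Matrix (Fin k) (Fin k) R) c) :=
    ⟨⟨lowerBlock 1 c, lowerBlock 1 (-c), by simp [lowerBlock_mul, lowerBlock_one_zero],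
      by simp [lowerBlock_mul, lowerBlock_one_zero]⟩, rfl⟩
  simpa [addOne_eq_lowerBlock, lowerBlock_mul] using (isUnit_addOne hT).mul h

theorem inverse_mulVec_eq {m : ℕ} {M : Matrix (Fin m) (Fin m) R} (hM : IsUnit M)
    {v w : Fin m → R} (h : M *ᵥ v = w) : Ring.inverse M *ᵥ w = v := by
  rw [← h, Matrix.mulVec_mulVec, Ring.inverse_mul_cancel _ hM, Matrix.one_mulVec]

/-- The inverse of `M` also fixes the last vector, so it is block lower triangular too, and corners
multiply on such matrices. Block triangularity of `M` alone would give only a one-sided inverse of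
the corner. -/
theorem isUnit_corner {M : Matrix (Fin (k + 1)) (Fin (k + 1)) R} (hM : IsUnit M)
    (h : M *ᵥ lastVec k R = lastVec k R) : IsUnit (corner M) := by
  have e := eq_lowerBlock h
  have e' := eq_lowerBlock (inverse_mulVec_eq hM h)
  have h₁ := congrArg corner (Ring.mul_inverse_cancel M hM)
  have h₂ := congrArg corner (Ring.inverse_mul_cancel M hM)
  rw [← lowerBlock_one_zero, corner_lowerBlock] at h₁ h₂
  rw [e', e, lowerBlock_mul, corner_lowerBlock, ← e] at h₁ h₂
  exact ⟨⟨_, _, h₁, h₂⟩, rfl⟩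

theorem isUnit_inverse {S : Type*} [Ring S] {M : S} (hM : IsUnit M) : IsUnit (Ring.inverse M) :=
  ⟨⟨_, _, Ring.inverse_mul_cancel M hM, Ring.mul_inverse_cancel M hM⟩, rfl⟩

theorem lastVec_mem_Lg : lastVec k R ∈ Lg (k + 1) R :=
  ⟨lastVec k R, by simp [lastVec, Pi.single_apply]⟩

theorem actsTransitively_succ_iff :
    ActsTransitively (k + 1) R ↔ ∀ a ∈ Lg (k + 1) R,
      ∃ T : Matrix (Fin (k + 1)) (Fin (k + 1)) R, IsUnit T ∧ T *ᵥ lastVec k R = a := by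
  constructor
  · intro h a ha
    obtain ⟨T, hT⟩ := h _ lastVec_mem_Lg a ha
    exact ⟨T.1, T.2, hT⟩
  · intro h a ha b hb
    obtain ⟨S, hS, rfl⟩ := h a ha
    obtain ⟨T, hT, rfl⟩ := h b hb
    refine ⟨⟨T * Ring.inverse S, hT.mul (isUnit_inverse hS)⟩, ?_⟩
    simp only [← Matrix.mulVec_mulVec]
    rw [inverse_mulVec_eq hS rfl]

theorem map_mulVec_lastVec {S : Type*} [Ring S] (f : R →+* S)
    (T : Matrix (Fin (k + 1)) (Fin (k + 1)) R) :
    T.map f *ᵥ lastVec k S = f ∘ (T *ᵥ lastVec k R) := by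
  ext i
  simp [mulVec_lastVec]

theorem comp_mem_Lg {S : Type*} [Ring S] {m : ℕ} (f : R →+* S) {a : Fin m → R}
    (ha : a ∈ Lg m R) : f ∘ a ∈ Lg m S := by
  obtain ⟨a', h⟩ := ha
  exact ⟨f ∘ a', by simp [← map_mul, ← map_sum, h]⟩

/-- Transitivity passes to a retract of a ring. -/
theorem ActsTransitively.of_retract {S : Type*} [Ring S] (f : R →+* S) (g : S →+* R)
    (hfg : ∀ s, f (g s) = s) (h : ActsTransitively (k + 1) R) : ActsTransitively (k + 1) S := by
  rw [actsTransitively_succ_iff] at h ⊢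
  intro a ha
  obtain ⟨T, hT, hTa⟩ := h _ (comp_mem_Lg g ha)
  refine ⟨T.map f, hT.map f.mapMatrix, ?_⟩
  rw [map_mulVec_lastVec, hTa]
  ext i
  simp [hfg]

end Algebra

/-! ### Invertible matrix functions and homotopy lifting -/

section Topology

variable {A : Type*} [NormedRing A] {m : ℕ}

attribute [local instance] Matrix.linftyOpNormedRing in
theorem isOpen_isUnit_matrix [CompleteSpace A] : IsOpen {M : Matrix (Fin m) (Fin m) A | IsUnit M} := by
  have : @CompleteSpace (Matrix (Fin m) (Fin m) A) PseudoMetricSpace.toUniformSpace :=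
    inferInstanceAs (CompleteSpace (Fin m → Fin m → A))
  exact Units.isOpen

attribute [local instance] Matrix.linftyOpNormedRing in
theorem continuousAt_inverse_matrix [CompleteSpace A] {M : Matrix (Fin m) (Fin m) A} (hM : IsUnit M) :
    ContinuousAt Ring.inverse M := by
  have : @CompleteSpace (Matrix (Fin m) (Fin m) A) PseudoMetricSpace.toUniformSpace :=
    inferInstanceAs (CompleteSpace (Fin m → Fin m → A))
  obtain ⟨u, rfl⟩ := hM
  exact NormedRing.inverse_continuousAt u

theorem _root_.Continuous.matrix_inverse [CompleteSpace A] {Y : Type*} [TopologicalSpace Y]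
    {F : Y → Matrix (Fin m) (Fin m) A} (hF : Continuous F) (hu : ∀ y, IsUnit (F y)) :
    Continuous fun y => Ring.inverse (F y) :=
  continuous_iff_continuousAt.2 fun y =>
    (continuousAt_inverse_matrix (hu y)).comp hF.continuousAt

/-- The matrix over `C(Y, A)` of a continuous matrix-valued function. -/
def matrixOfContinuous {Y : Type*} [TopologicalSpace Y] (F : C(Y, Matrix (Fin m) (Fin m) A)) :
    Matrix (Fin m) (Fin m) C(Y, A) :=
  Matrix.of fun i j => ⟨fun y => F y i j, F.continuous.matrix_elem i j⟩

theorem matrixOfContinuous_mul {Y : Type*} [TopologicalSpace Y]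
    (F G : C(Y, Matrix (Fin m) (Fin m) A)) :
    matrixOfContinuous (F * G) = matrixOfContinuous F * matrixOfContinuous G := by
  ext i j y
  simp [matrixOfContinuous, Matrix.mul_apply]

theorem matrixOfContinuous_one {Y : Type*} [TopologicalSpace Y] :
    matrixOfContinuous (1 : C(Y, Matrix (Fin m) (Fin m) A)) = 1 := by
  ext i j y
  simp [matrixOfContinuous, Matrix.one_apply]
  split_ifs <;> rfl

theorem isUnit_matrixOfContinuous [CompleteSpace A] {Y : Type*} [TopologicalSpace Y]
    (F : C(Y, Matrix (Fin m) (Fin m) A)) (hu : ∀ y, IsUnit (F y)) :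
    IsUnit (matrixOfContinuous F) := by
  let G : C(Y, Matrix (Fin m) (Fin m) A) := ⟨_, F.continuous.matrix_inverse hu⟩
  refine ⟨⟨matrixOfContinuous F, matrixOfContinuous G, ?_, ?_⟩, rfl⟩
  · rw [← matrixOfContinuous_mul, ← matrixOfContinuous_one]
    congr 1
    ext1 y
    exact Ring.mul_inverse_cancel _ (hu y)
  · rw [← matrixOfContinuous_mul, ← matrixOfContinuous_one]
    congr 1
    ext1 y
    exact Ring.inverse_mul_cancel _ (hu y)

/-- The evaluation of a matrix over `C(Y, A)` at a point. -/
def evalMatrix {Y : Type*} [TopologicalSpace Y] (T : Matrix (Fin m) (Fin m) C(Y, A)) :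
    C(Y, Matrix (Fin m) (Fin m) A) where
  toFun y := T.map fun f => f y
  continuous_toFun := continuous_matrix fun i j => (T i j).continuous

theorem isUnit_evalMatrix {Y : Type*} [TopologicalSpace Y] {T : Matrix (Fin m) (Fin m) C(Y, A)}
    (hT : IsUnit T) (y : Y) : IsUnit (evalMatrix T y) :=
  hT.map ((Pi.evalRingHom (fun _ : Y => A) y).comp ContinuousMap.coeFnRingHom).mapMatrix

theorem evalMatrix_mulVec_lastVec {Y : Type*} [TopologicalSpace Y] {k : ℕ}
    (T : Matrix (Fin (k + 1)) (Fin (k + 1)) C(Y, A)) (y : Y) :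
    evalMatrix T y *ᵥ lastVec k A = fun i => (T *ᵥ lastVec k C(Y, A)) i y := by
  ext i
  simp [mulVec_lastVec, evalMatrix]

theorem _root_.Continuous.corner {Y : Type*} [TopologicalSpace Y] {k : ℕ}
    {F : Y → Matrix (Fin (k + 1)) (Fin (k + 1)) A} (hF : Continuous F) :
    Continuous fun y => corner (F y) :=
  continuous_matrix fun _ _ => hF.matrix_elem _ _

theorem _root_.Continuous.bottomRow {Y : Type*} [TopologicalSpace Y] {k : ℕ}
    {F : Y → Matrix (Fin (k + 1)) (Fin (k + 1)) A} (hF : Continuous F) :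
    Continuous fun y => bottomRow (F y) :=
  continuous_matrix fun _ _ => hF.matrix_elem _ _

theorem _root_.Continuous.lowerBlock {Y : Type*} [TopologicalSpace Y] {k : ℕ}
    {F : Y → Matrix (Fin k) (Fin k) A} (hF : Continuous F) {c : Y → Matrix (Fin 1) (Fin k) A}
    (hc : Continuous c) : Continuous fun y => lowerBlock (F y) (c y) :=
  (hF.matrix_fromBlocks continuous_const hc continuous_const).matrix_reindex _ _

/-- If `v' v = 1`, the matrix `1 + (w - v) v'` maps `v` to `w`. -/
theorem one_add_vecMulVec_mulVec {v v' w : Fin m → A} (h : v' ⬝ᵥ v = 1) :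
    (1 + Matrix.vecMulVec (w - v) v') *ᵥ v = w := by
  rw [Matrix.add_mulVec, Matrix.one_mulVec]
  ext i
  have : (Matrix.vecMulVec (w - v) v' *ᵥ v) i = (w - v) i * (v' ⬝ᵥ v) := by
    simp [Matrix.mulVec, dotProduct, Matrix.vecMulVec_apply, Finset.mul_sum, mul_assoc]
  rw [Pi.add_apply, this, h]
  simp

/-- `Φ` carries v(s, x) to v(t, x) and is 1 for s = t, hence invertible for s, t close, uniformly in
x by compactness. The lift is a product of such factors over a subdivision. Clamping time at `a n`
keeps each partial product continuous on all of I × X, without gluing. -/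
theorem exists_clamped_lift [CompleteSpace A] {X : Type*} [TopologicalSpace X] [CompactSpace X]
    {v v' : I × X → Fin m → A} (hv : Continuous v) (hv' : Continuous v')
    (h : ∀ p, v' p ⬝ᵥ v p = 1) :
    ∃ a : ℕ → I, (∃ n, a n = 1) ∧ ∀ n, ∃ H : C(I × X, Matrix (Fin m) (Fin m) A),
      (∀ p, IsUnit (H p)) ∧ (∀ x, H (0, x) = 1) ∧
      (∀ x, (∀ t, v (t, x) = v (0, x)) → ∀ t, H (t, x) = 1) ∧
      ∀ t x, H (t, x) *ᵥ v (0, x) = v (min t (a n), x) := by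
  let Φ : (I × I) × X → Matrix (Fin m) (Fin m) A := fun q =>
    1 + Matrix.vecMulVec (v (q.1.2, q.2) - v (q.1.1, q.2)) (v' (q.1.1, q.2))
  have hΦ : Continuous Φ := by fun_prop
  have hU : {q : I × I | ∀ x, IsUnit (Φ (q, x))} ∈ uniformity I := by
    rw [← nhdsSet_diagonal_eq_uniformity]
    refine IsOpen.mem_nhdsSet ?_ |>.2 ?_
    -- Projection along the compact space X is closed, so the pairs good for every x form an open
    -- set.
    · have := (isClosedMap_fst_of_compactSpace (X := I × I) (Y := X)) _
        (isOpen_isUnit_matrix.preimage hΦ).isClosed_compl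
      rw [← isOpen_compl_iff] at this
      convert this using 1
      ext q
      simp
    · rintro ⟨s, t⟩ hst x
      obtain rfl : s = t := hst
      simp [Φ, isUnit_one]
  obtain ⟨δ, hδ, hδU⟩ := Metric.mem_uniformity_dist.1 hU
  let a : ℕ → I := fun n => projIcc 0 1 zero_le_one (n * (δ / 2))
  have ha0 : a 0 = 0 := by simp [a, projIcc_left]
  refine ⟨a, ?_, fun n => ?_⟩
  · obtain ⟨n, hn⟩ := exists_nat_ge (1 / (δ / 2))
    exact ⟨n, projIcc_of_right_le _ ((div_le_iff₀ (by positivity)).1 hn)⟩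
  induction n with
  | zero =>
    refine ⟨1, fun _ => isUnit_one, fun _ => rfl, fun _ _ _ => rfl, fun t x => ?_⟩
    rw [ha0, min_eq_right unitInterval.nonneg']
    simp
  | succ n ih =>
    obtain ⟨H, hHu, hH0, hHx, hH⟩ := ih
    -- For times up to `a n` both clamped times agree and the new factor is 1.
    refine ⟨⟨fun p => Φ ((min p.1 (a n), min p.1 (a (n + 1))), p.2) * H p, ?_⟩,
      fun p => ?_, fun x => ?_, fun x hx t => ?_, fun t x => ?_⟩
    · fun_prop
    · refine IsUnit.mul (hδU ?_ p.2) (hHu p)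
      rw [Subtype.dist_eq, Real.dist_eq]
      have h1 : |(a n : ℝ) - a (n + 1)| ≤ δ / 2 := by
        have := abs_projIcc_sub_projIcc (a := (0 : ℝ)) (b := 1) (c := n * (δ / 2))
          (d := (n + 1 : ℕ) * (δ / 2)) zero_le_one
        refine this.trans (le_of_eq ?_)
        push_cast
        rw [show (n : ℝ) * (δ / 2) - (n + 1) * (δ / 2) = -(δ / 2) by ring, abs_neg,
          abs_of_pos (by positivity)]
      have h2 : ∀ s t : I, ((min s t : I) : ℝ) = min (s : ℝ) t := fun s t =>
        (Subtype.mono_coe _).map_min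
      rw [h2, h2]
      refine lt_of_le_of_lt ?_ (half_lt_self hδ)
      refine (abs_min_sub_min_le_max _ _ _ _).trans ?_
      simpa using h1
    · simp [Φ, hH0]
    · simp [Φ, hHx x hx, hx (min t _)]
    · change (Φ ((min t (a n), min t (a (n + 1))), x) * H (t, x)) *ᵥ v (0, x) = _
      rw [← Matrix.mulVec_mulVec, hH]
      exact one_add_vecMulVec_mulVec (h _)

/-- A homotopy of left unimodular vectors lifts to a path of invertible matrices. -/
theorem exists_lift [CompleteSpace A] {X : Type*} [TopologicalSpace X] [CompactSpace X]
    {v v' : I × X → Fin m → A} (hv : Continuous v) (hv' : Continuous v')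
    (h : ∀ p, v' p ⬝ᵥ v p = 1) :
    ∃ H : C(I × X, Matrix (Fin m) (Fin m) A), (∀ p, IsUnit (H p)) ∧ (∀ x, H (0, x) = 1) ∧
      (∀ x, (∀ t, v (t, x) = v (0, x)) → ∀ t, H (t, x) = 1) ∧
      ∀ t x, H (t, x) *ᵥ v (0, x) = v (t, x) := by
  obtain ⟨a, ⟨n, hn⟩, ha⟩ := exists_clamped_lift hv hv' h
  obtain ⟨H, h1, h2, h3, h4⟩ := ha n
  refine ⟨H, h1, h2, h3, fun t x => ?_⟩
  rw [h4, hn, min_eq_left unitInterval.le_one']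

end Topology

/-! ### Null-homotopies, the suspension, and the criterion in each size -/

section Homotopy

variable {A : Type*} [NormedRing A] {m k : ℕ} {X : Type*} [TopologicalSpace X]

/-- An invertible matrix-valued function is null-homotopic (relative to the base point) if it is
joined to the constant function `1` through invertible matrices. -/
def NullHomotopic (x₀ : X) (F : X → Matrix (Fin m) (Fin m) A) : Prop :=
  ∃ K : C(I × X, Matrix (Fin m) (Fin m) A), (∀ p, IsUnit (K p)) ∧ (∀ x, K (0, x) = 1) ∧
    (∀ x, K (1, x) = F x) ∧ ∀ t, K (t, x₀) = 1

theorem homotopicRel_iff {x₀ : X} {f g : C(X, GLn m A)} (hf : f x₀ = GLn.one m A) :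
    ContinuousMap.HomotopicRel f g {x₀} ↔
      ∃ K : C(I × X, Matrix (Fin m) (Fin m) A), (∀ p, IsUnit (K p)) ∧
        (∀ x, K (0, x) = (f x).1) ∧ (∀ x, K (1, x) = (g x).1) ∧ ∀ t, K (t, x₀) = 1 := by
  constructor
  · rintro ⟨H⟩
    refine ⟨⟨fun p => (H p).1, by fun_prop⟩, fun p => (H p).2, fun x => ?_, fun x => ?_,
      fun t => ?_⟩
    · simp
    · simp
    · simp [H.eq_fst t (mem_singleton x₀), hf, GLn.one]
  · rintro ⟨K, hK, h0, h1, hx⟩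
    refine ⟨⟨⟨⟨fun p => ⟨K p, hK p⟩, by fun_prop⟩, fun x => Subtype.ext (h0 x),
      fun x => Subtype.ext (h1 x)⟩, fun t x hxx => ?_⟩⟩
    obtain rfl : x = x₀ := hxx
    rw [hf]
    exact Subtype.ext (hx t)

/-- Pointwise multiplication makes the classes groups and the induced map a homomorphism, so
triviality of the kernel suffices: compare `g` and `f` through g⁻¹f. -/
theorem injective_map_theta_iff [CompleteSpace A] (x₀ : X) :
    Function.Injective (BasedClasses.map x₀ (theta k A) (theta_one k A)) ↔
      ∀ F : C(X, Matrix (Fin k) (Fin k) A), (∀ x, IsUnit (F x)) → F x₀ = 1 →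
        NullHomotopic x₀ (fun x => addOne (F x)) → NullHomotopic x₀ F := by
  constructor
  · rintro h F hF hF0 ⟨K, hK⟩
    let f : {f : C(X, GLn k A) // f x₀ = GLn.one k A} :=
      ⟨⟨fun x => ⟨F x, hF x⟩, by fun_prop⟩, Subtype.ext hF0⟩
    let e : {f : C(X, GLn k A) // f x₀ = GLn.one k A} := ⟨.const X (GLn.one k A), rfl⟩
    have key : (Quotient.mk (basedSetoid x₀ (GLn.one k A)) e) = Quotient.mk _ f :=
      h (Quotient.sound ((homotopicRel_iff (x₀ := x₀) (theta_one k A)).2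
        ⟨K, hK.1, fun x => (hK.2.1 x).trans (addOne_one k).symm, hK.2.2⟩))
    exact (homotopicRel_iff rfl).1 (Quotient.exact key)
  · intro h a b
    induction a using Quotient.inductionOn with | _ g
    induction b using Quotient.inductionOn with | _ f
    intro hab
    obtain ⟨H, hH, h0, h1, hx⟩ := (homotopicRel_iff (by
      rw [ContinuousMap.comp_apply, g.2, theta_one])).1 (Quotient.exact hab)
    have hg : Continuous fun x => Ring.inverse (g.1 x).1 :=
      Continuous.matrix_inverse (by fun_prop) fun x => (g.1 x).2
    have hgu : ∀ x, IsUnit (Ring.inverse (g.1 x).1) := fun x => isUnit_inverse (g.1 x).2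
    have hc : Continuous fun p : I × X => addOne (Ring.inverse (g.1 p.2).1) * H p :=
      ((hg.comp continuous_snd).lowerBlock (c := fun _ => 0) continuous_const).matrix_mul
        H.continuous
    obtain ⟨K, hK, k0, k1, kx⟩ := h ⟨fun x => Ring.inverse (g.1 x).1 * (f.1 x).1, by fun_prop⟩
      (fun x => (hgu x).mul (f.1 x).2) (by simp [g.2, f.2, GLn.one])
      ⟨⟨fun p => addOne (Ring.inverse (g.1 p.2).1) * H p, hc⟩,
        fun p => (isUnit_addOne (hgu p.2)).mul (hH p),
        fun x => by
          simp only [ContinuousMap.coe_mk, h0]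
          exact (addOne_mul _ _).trans
            (by rw [Ring.inverse_mul_cancel _ (g.1 x).2, addOne_one]),
        fun x => by
          simp only [ContinuousMap.coe_mk, h1]
          exact addOne_mul _ _,
        fun t => by simp [hx, g.2, GLn.one, addOne_one]⟩
    refine Quotient.sound ((homotopicRel_iff g.2).2 ⟨⟨fun p => (g.1 p.2).1 * K p, by fun_prop⟩,
      fun p => (g.1 p.2).2.mul (hK p), fun x => by simp [k0], fun x => ?_,
      fun t => by simp [kx, g.2, GLn.one]⟩)
    simp [k1, Ring.mul_inverse_cancel_left _ _ (g.1 x).2]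

/-- A continuous function on `I × X` that is constant on the collapsed subset descends to the
suspension. -/
def suspensionLift {Z : Type*} [TopologicalSpace Z] (x₀ : X) (F : C(I × X, Z)) (z : Z)
    (h : ∀ p ∈ suspensionCollapse x₀, F p = z) : C(Suspension x₀, Z) where
  toFun := Quotient.lift F (by
    rintro p q (rfl | ⟨hp, hq⟩)
    · rfl
    · rw [h p hp, h q hq])
  continuous_toFun := F.continuous.quotient_lift _

/-- The quotient map onto the suspension. -/
def suspensionMk (x₀ : X) : C(I × X, Suspension x₀) := ⟨Quotient.mk _, continuous_quotient_mk'⟩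

@[simp] theorem suspensionLift_mk {Z : Type*} [TopologicalSpace Z] (x₀ : X) (F : C(I × X, Z))
    (z : Z) (h : ∀ p ∈ suspensionCollapse x₀, F p = z) (p : I × X) :
    suspensionLift x₀ F z h (suspensionMk x₀ p) = F p := rfl

theorem suspensionMk_surjective (x₀ : X) : Function.Surjective (suspensionMk x₀) :=
  Quotient.mk_surjective

theorem suspensionMk_eq {x₀ : X} {p : I × X} (hp : p ∈ suspensionCollapse x₀) :
    suspensionMk x₀ p = suspensionMk x₀ (0, x₀) :=
  Quotient.sound (Or.inr ⟨hp, Or.inl rfl⟩)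

theorem lastVec_vecMul_addOne {R : Type*} [Ring R] (T : Matrix (Fin k) (Fin k) R) :
    lastVec k R ᵥ* addOne T = lastVec k R := by
  ext j
  obtain ⟨j | j, rfl⟩ := finSumFinEquiv.surjective j
  · simp only [lastVec, ← finSumFinEquiv_inr_zero 0, Matrix.single_one_vecMul, addOne]
    rw [Pi.single_eq_of_ne (finSumFinEquiv.injective.ne (by simp))]
    simp [-finSumFinEquiv_apply_left, -finSumFinEquiv_apply_right]
  · obtain rfl := Subsingleton.elim j 0
    simp [lastVec, ← finSumFinEquiv_inr_zero 0, addOne, -finSumFinEquiv_apply_right]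

/-- The vector H e built from a contraction `H` of diag(F, 1) descends to ΣX. Comparing `H` with a
lift `S` of that vector over ΣX moves the contraction into the stabiliser of e. -/
theorem nullHomotopic_of_actsTransitively [CompleteSpace A] {x₀ : X}
    (h : ActsTransitively (k + 1) C(Suspension x₀, A)) {F : X → Matrix (Fin k) (Fin k) A}
    (hF : NullHomotopic x₀ fun x => addOne (F x)) : NullHomotopic x₀ F := by
  obtain ⟨H, hH, h0, h1, hx⟩ := hF
  have hcol : ∀ p ∈ suspensionCollapse x₀, H p *ᵥ lastVec k A = lastVec k A := by
    rintro ⟨t, x⟩ (rfl | rfl | rfl)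
    · rw [h0, Matrix.one_mulVec]
    · rw [h1]
      exact lowerBlock_mulVec_lastVec _ _
    · rw [hx, Matrix.one_mulVec]
  have hrow : ∀ p ∈ suspensionCollapse x₀,
      lastVec k A ᵥ* Ring.inverse (H p) = lastVec k A := by
    intro p hp
    suffices hs : lastVec k A ᵥ* H p = lastVec k A by
      nth_rw 1 [← hs]
      rw [Matrix.vecMul_vecMul, Ring.mul_inverse_cancel _ (hH p), Matrix.vecMul_one]
    obtain ⟨t, x⟩ := p
    obtain rfl | rfl | rfl := hp
    · rw [h0, Matrix.vecMul_one]
    · rw [h1]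
      exact lastVec_vecMul_addOne _
    · rw [hx, Matrix.vecMul_one]
  have hHi : Continuous fun p => Ring.inverse (H p) := H.continuous.matrix_inverse hH
  let v : Fin (k + 1) → C(Suspension x₀, A) := fun i =>
    suspensionLift x₀ ⟨fun p => (H p *ᵥ lastVec k A) i, by fun_prop⟩ (lastVec k A i)
      fun p hp => congrFun (hcol p hp) i
  -- The row eᵀH⁻¹ witnesses unimodularity of H e, and descends because diag(F, 1) also fixes eᵀ
  -- from the right.
  let v' : Fin (k + 1) → C(Suspension x₀, A) := fun i =>
    suspensionLift x₀ ⟨fun p => (lastVec k A ᵥ* Ring.inverse (H p)) i, by fun_prop⟩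
      (lastVec k A i) fun p hp => congrFun (hrow p hp) i
  have hv : v ∈ Lg (k + 1) C(Suspension x₀, A) := by
    refine ⟨v', ?_⟩
    ext1 y
    obtain ⟨p, rfl⟩ := suspensionMk_surjective x₀ y
    rw [ContinuousMap.sum_apply]
    change (lastVec k A ᵥ* Ring.inverse (H p)) ⬝ᵥ (H p *ᵥ lastVec k A) = 1
    rw [Matrix.dotProduct_mulVec, Matrix.vecMul_vecMul, Ring.inverse_mul_cancel _ (hH p),
      Matrix.vecMul_one]
    simp [lastVec]
  obtain ⟨T, hT, hTv⟩ := actsTransitively_succ_iff.1 h v hv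
  let S : C(I × X, Matrix (Fin (k + 1)) (Fin (k + 1)) A) :=
    (evalMatrix T).comp (suspensionMk x₀)
  have hS : ∀ p, IsUnit (S p) := fun p => isUnit_evalMatrix hT _
  have hSv : ∀ p, S p *ᵥ lastVec k A = H p *ᵥ lastVec k A := fun p => by
    change evalMatrix T (suspensionMk x₀ p) *ᵥ _ = _
    rw [evalMatrix_mulVec_lastVec, hTv]
    rfl
  have hSi : Continuous fun p => Ring.inverse (S p) := S.continuous.matrix_inverse hS
  have hS0 : ∀ p ∈ suspensionCollapse x₀, S p = S (0, x₀) := fun p hp =>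
    congrArg (evalMatrix T) (suspensionMk_eq hp)
  let s := S (0, x₀)
  have hs : s *ᵥ lastVec k A = lastVec k A := (hSv _).trans (hcol _ (Or.inl rfl))
  -- S⁻¹H fixes e. The factor `s`, the constant value of `S` on the collapsed set, restores the
  -- boundary values of `H`.
  let G : C(I × X, Matrix (Fin (k + 1)) (Fin (k + 1)) A) :=
    ⟨fun p => s * (Ring.inverse (S p) * H p), by fun_prop⟩
  have hG : ∀ p, IsUnit (G p) := fun p => (hS _).mul ((isUnit_inverse (hS p)).mul (hH p))
  have hGe : ∀ p, G p *ᵥ lastVec k A = lastVec k A := fun p => by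
    change (s * (Ring.inverse (S p) * H p)) *ᵥ _ = _
    rw [← Matrix.mulVec_mulVec, ← Matrix.mulVec_mulVec, inverse_mulVec_eq (hS p) (hSv p), hs]
  have hGc : ∀ p ∈ suspensionCollapse x₀, G p = H p := fun p hp => by
    change s * (Ring.inverse (S p) * H p) = _
    rw [hS0 p hp, Ring.mul_inverse_cancel_left _ _ (hS _)]
  have hc1 : corner (1 : Matrix (Fin (k + 1)) (Fin (k + 1)) A) = 1 := by
    rw [← lowerBlock_one_zero, corner_lowerBlock]
  refine ⟨⟨fun p => corner (G p), G.continuous.corner⟩, fun p => isUnit_corner (hG p) (hGe p),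
    fun x => ?_, fun x => ?_, fun t => ?_⟩
  · change corner (G (0, x)) = _
    rw [hGc _ (Or.inl rfl), h0, hc1]
  · change corner (G (1, x)) = _
    rw [hGc _ (Or.inr (Or.inl rfl)), h1]
    exact corner_lowerBlock _ _
  · change corner (G (t, x₀)) = _
    rw [hGc _ (Or.inr (Or.inr rfl)), hx, hc1]

theorem actsTransitively_suspension [CompleteSpace A] [CompactSpace X] {x₀ : X}
    (hA : ActsTransitively (k + 1) A)
    (h : ∀ F : C(X, Matrix (Fin k) (Fin k) A), (∀ x, IsUnit (F x)) → F x₀ = 1 →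
        NullHomotopic x₀ (fun x => addOne (F x)) → NullHomotopic x₀ F) :
    ActsTransitively (k + 1) C(Suspension x₀, A) := by
  rw [actsTransitively_succ_iff]
  rintro a ⟨a', haa⟩
  have haa' : ∀ y, (fun i => a' i y) ⬝ᵥ (fun i => a i y) = 1 := fun y => by
    simpa [dotProduct] using congrArg (fun f => f y) haa
  -- Transitivity over A normalises the value at the base point to e.
  obtain ⟨S, hS, hSa⟩ := actsTransitively_succ_iff.1 hA
    (fun i => a i (suspensionMk x₀ (0, x₀))) ⟨_, haa' _⟩
  let v : I × X → Fin (k + 1) → A := fun p => Ring.inverse S *ᵥ fun i => a i (suspensionMk x₀ p)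
  let v' : I × X → Fin (k + 1) → A := fun p => (fun i => a' i (suspensionMk x₀ p)) ᵥ* S
  have hv : Continuous v := by fun_prop
  have hv' : Continuous v' := by fun_prop
  have hvv : ∀ p, v' p ⬝ᵥ v p = 1 := fun p => by
    rw [Matrix.dotProduct_mulVec, Matrix.vecMul_vecMul, Ring.mul_inverse_cancel _ hS,
      Matrix.vecMul_one, haa']
  have hvc : ∀ p ∈ suspensionCollapse x₀, v p = lastVec k A := fun p hp => by
    simp only [v, suspensionMk_eq hp]
    exact inverse_mulVec_eq hS hSa
  obtain ⟨H, hH, h0, hx, hHv⟩ := exists_lift hv hv' hvv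
  replace hx : ∀ t, H (t, x₀) = 1 :=
    hx x₀ fun t => (hvc _ (Or.inr (Or.inr rfl))).trans (hvc _ (Or.inl rfl)).symm
  replace hHv : ∀ p, H p *ᵥ lastVec k A = v p := fun p => by
    rw [← hvc (0, p.2) (Or.inl rfl), hHv]
  have h1 : ∀ x, H (1, x) = lowerBlock (corner (H (1, x))) (bottomRow (H (1, x))) := fun x =>
    eq_lowerBlock ((hHv _).trans (hvc _ (Or.inr (Or.inl rfl))))
  have hc1 : corner (1 : Matrix (Fin (k + 1)) (Fin (k + 1)) A) = 1 := by
    rw [← lowerBlock_one_zero, corner_lowerBlock]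
  have hb1 : bottomRow (1 : Matrix (Fin (k + 1)) (Fin (k + 1)) A) = 0 := by
    rw [← lowerBlock_one_zero, bottomRow_lowerBlock]
  have hH1 : Continuous fun x => H (1, x) := by fun_prop
  have hb : Continuous fun p => bottomRow (H p) := H.continuous.bottomRow
  obtain ⟨N, hN, n0, n1, nx⟩ := h ⟨fun x => corner (H (1, x)), hH1.corner⟩
    (fun x => isUnit_corner (hH _) ((hHv _).trans (hvc _ (Or.inr (Or.inl rfl)))))
    (by simp [hx, hc1])
    -- This factor clears the bottom row at t = 1, and is 1 at t = 0 and over x₀, where that row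
    -- vanishes.
    ⟨⟨fun p => H p * lowerBlock 1 (-bottomRow (H p)),
      H.continuous.matrix_mul (continuous_const.lowerBlock hb.neg)⟩,
      fun p => (hH p).mul (isUnit_lowerBlock isUnit_one _),
      fun x => by simp [h0, hb1, lowerBlock_one_zero],
      fun x => by
        change H (1, x) * lowerBlock 1 (-bottomRow (H (1, x))) = _
        nth_rw 1 [h1]
        simp [lowerBlock_mul, addOne_eq_lowerBlock],
      fun t => by simp [hx, hb1, lowerBlock_one_zero]⟩
  -- `J` stabilises e and agrees with `H` on the collapsed set. Thus HJ⁻¹ still lifts `v`, and it is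
  -- 1 there, so it descends.
  let J : C(I × X, Matrix (Fin (k + 1)) (Fin (k + 1)) A) :=
    ⟨fun p => lowerBlock (N p) (bottomRow (H p)), N.continuous.lowerBlock hb⟩
  have hJ : ∀ p, IsUnit (J p) := fun p => isUnit_lowerBlock (hN p) _
  have hJi : Continuous fun p => Ring.inverse (J p) := J.continuous.matrix_inverse hJ
  have hJc : ∀ p ∈ suspensionCollapse x₀, J p = H p := by
    rintro ⟨t, x⟩ (rfl | rfl | rfl)
    · simp [J, n0, h0, hb1, lowerBlock_one_zero]
    · rw [h1]
      simp [J, n1]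
    · simp [J, nx, hx, hb1, lowerBlock_one_zero]
  let T := suspensionLift x₀ ⟨fun p => S * (H p * Ring.inverse (J p)), by fun_prop⟩ S
    fun p hp => by simp [hJc p hp, Ring.mul_inverse_cancel _ (hH p)]
  refine ⟨matrixOfContinuous T, isUnit_matrixOfContinuous T fun y => ?_, ?_⟩
  · obtain ⟨p, rfl⟩ := suspensionMk_surjective x₀ y
    exact hS.mul ((hH p).mul (isUnit_inverse (hJ p)))
  · ext i y
    obtain ⟨p, rfl⟩ := suspensionMk_surjective x₀ y
    have e := evalMatrix_mulVec_lastVec (matrixOfContinuous T) (suspensionMk x₀ p)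
    refine (congrFun e i).symm.trans ?_
    change ((S * (H p * Ring.inverse (J p))) *ᵥ lastVec k A) i = _
    rw [← Matrix.mulVec_mulVec, ← Matrix.mulVec_mulVec,
      inverse_mulVec_eq (hJ p) (lowerBlock_mulVec_lastVec _ _), hHv, Matrix.mulVec_mulVec,
      Ring.mul_inverse_cancel _ hS, Matrix.one_mulVec]

theorem actsTransitively_suspension_iff [CompleteSpace A] [CompactSpace X] (x₀ : X) :
    ActsTransitively (k + 1) C(Suspension x₀, A) ↔ ActsTransitively (k + 1) A ∧
      Function.Injective (BasedClasses.map x₀ (theta k A) (theta_one k A)) := by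
  rw [injective_map_theta_iff]
  refine ⟨fun h => ⟨?_, fun F _ _ => nullHomotopic_of_actsTransitively h⟩,
    fun h => actsTransitively_suspension h.1 h.2⟩
  -- Evaluation at a point retracts C(ΣX, A) onto the constants A.
  let y := suspensionMk x₀ (0, x₀)
  exact h.of_retract ((Pi.evalRingHom (fun _ => A) y).comp ContinuousMap.coeFnRingHom)
    ⟨⟨⟨.const _, rfl⟩, fun _ _ => rfl⟩, rfl, fun _ _ => rfl⟩ fun _ => rfl

end Homotopy

/-! ### Least elements of upper sets, and the conclusion -/

theorem sInf_image_cast_inter {s t : Set ℕ} (hs : IsUpperSet s) (ht : IsUpperSet t) :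
    sInf ((fun n : ℕ => (n : ℕ∞)) '' (s ∩ t)) =
      max (sInf ((fun n : ℕ => (n : ℕ∞)) '' s)) (sInf ((fun n : ℕ => (n : ℕ∞)) '' t)) := by
  apply le_antisymm
  · by_contra! hlt
    obtain ⟨h1, h2⟩ := max_lt_iff.1 hlt
    obtain ⟨_, ⟨a, ha, rfl⟩, ha'⟩ := sInf_lt_iff.1 h1
    obtain ⟨_, ⟨b, hb, rfl⟩, hb'⟩ := sInf_lt_iff.1 h2
    have : sInf ((fun n : ℕ => (n : ℕ∞)) '' (s ∩ t)) ≤ (max a b : ℕ) :=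
      sInf_le ⟨_, ⟨hs (le_max_left a b) ha, ht (le_max_right a b) hb⟩, rfl⟩
    rcases max_choice a b with h | h <;> rw [h] at this
    · exact this.not_gt ha'
    · exact this.not_gt hb'
  · exact max_le (sInf_le_sInf (image_mono inter_subset_left))
      (sInf_le_sInf (image_mono inter_subset_right))

end StableRank

theorem mainTheorem1 {X : Type*} [TopologicalSpace X] [CompactSpace X] [T2Space X] (x₀ : X)
    (A : Type*) [CStarAlgebra A] :
    StableRank.gsr C(StableRank.Suspension x₀, A) =
      max (StableRank.gsr A) (StableRank.inj x₀ A) := by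
  unfold StableRank.gsr StableRank.inj
  rw [← StableRank.sInf_image_cast_inter]
  · congr 2
    ext n
    constructor
    · rintro ⟨hn, h⟩
      refine ⟨⟨hn, fun m hm => ?_⟩, hn, fun k hk =>
        ((StableRank.actsTransitively_suspension_iff x₀).1 (h _ hk)).2⟩
      -- The bound n ≥ 1 excludes size 0, to which the criterion does not apply.
      obtain ⟨k, rfl⟩ := Nat.exists_eq_succ_of_ne_zero (by omega : m ≠ 0)
      exact ((StableRank.actsTransitively_suspension_iff x₀).1 (h _ hm)).1
    · rintro ⟨⟨hn, h⟩, -, h'⟩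
      refine ⟨hn, fun m hm => ?_⟩
      obtain ⟨k, rfl⟩ := Nat.exists_eq_succ_of_ne_zero (by omega : m ≠ 0)
      exact (StableRank.actsTransitively_suspension_iff x₀).2 ⟨h _ hm, h' k hm⟩
  · exact fun a b hab h => ⟨h.1.trans hab, fun m hm => h.2 m (hab.trans hm)⟩
  · exact fun a b hab h => ⟨h.1.trans hab, fun k hk => h.2 k (hab.trans hk)⟩
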